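/- Let $n\ge 0$ and $a=\xi_0<\xi_1<\dots<\xi_n<\xi_{n+1}=b$ be real numbers. Let $\rho_1,\dots,\rho_{n+1}$ be real with $\rho_k^2>0$, and let $q$ be a real-valued function that is continuous on each interval $(\xi_{k-1},\xi_k)$ and has finite one-sided limits at the end points of each of these intervals. Let $\delta_j,\gamma_j$ ($j=1,\dots,4$) and $\delta^{\pm}_{ij},\gamma^{\pm}_{ij}$ ($i=1,\dots,n$, $j=0,1$) be real numbers. For $1\le j<k\le 4$ let $\theta_{ijk}$ be the determinant formed by the $j$-th and $k$-th columns of $$\begin{pmatrix}\delta^+_{i1}&\delta^+_{i0}&\delta^-_{i1}&\delta^-_{i0}\\ \gamma^+_{i1}&\gamma^+_{i0}&\gamma^-_{i1}&\gamma^-_{i0}\end{pmatrix},$$ and let $\kappa_1=\delta_3\delta_2-\delta_4\delta_1$, $\kappa_2=\gamma_3\gamma_2-\gamma_4\gamma_1$. Assume $\theta_{ijk}>0$ for all $i$ and all $j<k$, and $\kappa_1,\kappa_2>0$. Let $\mathcal H=\bigoplus_{k=0}^{n}L_2(\xi_k,\xi_{k+1})\oplus\mathbb C^2$ be the complex Hilbert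 space with inner product $$\langle F,G\rangle=\sum_{k=0}^n\frac1{\rho_{k+1}^2}\prod_{i=1}^k\theta_{i12}\prod_{i=k+1}^n\theta_{i34}\int_{\xi_k}^{\xi_{k+1}}f\,\overline g\,dx+\frac{\prod_{i=1}^n\theta_{i34}}{\kappa_1}f_1\overline{g_1}+\frac{\prod_{i=1}^n\theta_{i12}}{\kappa_2}f_2\overline{g_2}$$ for $F=(f,f_1,f_2)$, $G=(g,g_1,g_2)$. Write $\ell f=-\rho_k^2f''+qf$ on $(\xi_{k-1},\xi_k)$, $k=1,\dots,n+1$, and $$B_a[f]=\delta_1f(a)-\delta_2f'(a),\quad B_a'[f]=\delta_3f(a)-\delta_4f'(a),\quad B_b[f]=\gamma_1f(b)-\gamma_2f'(b),\quad B_b'[f]=\gamma_3f(b)-\gamma_4f'(b),$$ where values at $a$ and $b$ are one-sided limits. Let $\mathfrak R$ be the linear operator in $\mathcal H$ whose domain consists of all $F=(f,B_a'[f],-B_b'[f])$ such that $f$ is differentiable on each $(\xi_{k-1},\xi_k)$, $f$ and $f'$ are locally absolutely continuous there and have finite one-sided limits at its end points, $\ell f\in L_2(\xi_{k-1},\xi_k)$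 for each $k$, and for $i=1,\dots,n$ $$\delta^-_{i1}f'(\xi_i-)+\delta^-_{i0}f(\xi_i-)+\delta^+_{i1}f'(\xi_i+)+\delta^+_{i0}f(\xi_i+)=0,$$ $$\gamma^-_{i1}f'(\xi_i-)+\gamma^-_{i0}f(\xi_i-)+\gamma^+_{i1}f'(\xi_i+)+\gamma^+_{i0}f(\xi_i+)=0,$$ and which acts by $\mathfrak R(f,B_a'[f],-B_b'[f])=(\ell f,B_a[f],B_b[f])$. Then $\mathfrak R$ has compact resolvent: for every real $\delta$ that is not an eigenvalue of $\mathfrak R$, the operator $\mathfrak R-\delta I$ maps the domain of $\mathfrak R$ bijectively onto $\mathcal H$, and its inverse $(\mathfrak R-\delta I)^{-1}:\mathcal H\to\mathcal H$ is a compact (in particular bounded) linear operator. -/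

import Mathlib

open MeasureTheory Set Filter Topology

noncomputable section

/-- Coefficients of a Sturm–Liouville problem on `(a, b)`, `a = ξ 0 < ξ 1 < ⋯ < ξ (n+1) = b`, with
spectral parameter in both boundary conditions and two transmission conditions at each of the
interior points `ξ 1, …, ξ n`. The pieces `(ξ k, ξ (k+1))` are indexed by `k : Fin (n + 1)`; the
interior points by `i : Fin n`, where `i` stands for the point `ξ (i+1)`. -/
structure BVTPData (n : ℕ) where
  ξ : Fin (n + 2) → ℝ
  ξ_strictMono : StrictMono ξ
  /-- the leading coefficient is `ρ k ^ 2` on the `k`-th piece -/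
  ρ : Fin (n + 1) → ℝ
  ρ_sq_pos : ∀ k, 0 < ρ k ^ 2
  /-- the potential -/
  q : ℝ → ℝ
  q_continuousOn : ∀ k : Fin (n + 1), ContinuousOn q (Ioo (ξ k.castSucc) (ξ k.succ))
  q_right_limit : ∀ k : Fin (n + 1), ∃ l : ℝ, Tendsto q (𝓝[>] (ξ k.castSucc)) (𝓝 l)
  q_left_limit : ∀ k : Fin (n + 1), ∃ l : ℝ, Tendsto q (𝓝[<] (ξ k.succ)) (𝓝 l)
  /-- coefficients of the boundary condition at `a` -/
  (δ₁ δ₂ δ₃ δ₄ : ℝ)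
  /-- coefficients of the boundary condition at `b` -/
  (γ₁ γ₂ γ₃ γ₄ : ℝ)
  /-- coefficients of the first transmission condition: `δm1`, `δm0`, `δp1`, `δp0` multiply
  `u'(ξ-)`, `u(ξ-)`, `u'(ξ+)`, `u(ξ+)` -/
  (δm1 δm0 δp1 δp0 : Fin n → ℝ)
  /-- coefficients of the second transmission condition, in the same order -/
  (γm1 γm0 γp1 γp0 : Fin n → ℝ)

namespace BVTPData

variable {n : ℕ} (P : BVTPData n)

/-- The `2 × 4` matrix of the transmission coefficients at the `i`-th interior point. -/
def transMatrix (i : Fin n) : Matrix (Fin 2) (Fin 4) ℝ :=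
  !![P.δp1 i, P.δp0 i, P.δm1 i, P.δm0 i;
     P.γp1 i, P.γp0 i, P.γm1 i, P.γm0 i]

/-- The determinant of columns `j` and `k` (counted from `0`) of the transmission matrix. -/
def θ (i : Fin n) (j k : Fin 4) : ℝ :=
  ((P.transMatrix i).submatrix id ![j, k]).det

def κ₁ : ℝ := !![P.δ₃, P.δ₄; P.δ₁, P.δ₂].det

def κ₂ : ℝ := !![P.γ₃, P.γ₄; P.γ₁, P.γ₂].det

end BVTPData

/-- The boundary value transmission problem: coefficients with all the minors `θ i j k`, `j < k`,
and both `κ₁`, `κ₂` positive. -/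
structure BVTP (n : ℕ) extends BVTPData n where
  θ_pos : ∀ (i : Fin n) (j k : Fin 4), j < k → 0 < toBVTPData.θ i j k
  κ₁_pos : 0 < toBVTPData.κ₁
  κ₂_pos : 0 < toBVTPData.κ₂

namespace BVTP

variable {n : ℕ} (P : BVTP n)

/-- The `k`-th open piece `(ξ k, ξ (k+1))`. -/
def piece (k : Fin (n + 1)) : Set ℝ := Ioo (P.ξ k.castSucc) (P.ξ k.succ)

/-- The `i`-th interior point. -/
def node (i : Fin n) : ℝ := P.ξ i.succ.castSucc

def a : ℝ := P.ξ 0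

def b : ℝ := P.ξ (Fin.last (n + 1))

/-! ### The Hilbert space -/

/-- The space `(L²(ξ 0, ξ 1) ⊕ ⋯ ⊕ L²(ξ n, ξ (n+1))) ⊕ ℂ²`. It carries the weighted inner product
defined below, not the norm of a product space. -/
def H : Type :=
  ((k : Fin (n + 1)) → Lp ℂ 2 (volume.restrict (P.piece k))) × ℂ × ℂ

instance : AddCommGroup P.H :=
  inferInstanceAs (AddCommGroup
    (((k : Fin (n + 1)) → Lp ℂ 2 (volume.restrict (P.piece k))) × ℂ × ℂ))

instance : Module ℂ P.H :=
  inferInstanceAs (Module ℂ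
    (((k : Fin (n + 1)) → Lp ℂ 2 (volume.restrict (P.piece k))) × ℂ × ℂ))

/-- The weight of the `k`-th piece: `ρ_k⁻²` times the product of the `θ_{i12}` over the interior
points to the left of the piece and of the `θ_{i34}` over those to its right. -/
def weight (k : Fin (n + 1)) : ℝ :=
  1 / P.ρ k ^ 2 * ((∏ i : Fin n with i.castSucc < k, P.θ i 0 1) *
    ∏ i : Fin n with k ≤ i.castSucc, P.θ i 2 3)

def weightA : ℝ := (∏ i : Fin n, P.θ i 2 3) / P.κ₁

def weightB : ℝ := (∏ i : Fin n, P.θ i 0 1) / P.κ₂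

lemma weight_pos (k : Fin (n + 1)) : 0 < P.weight k :=
  mul_pos (one_div_pos.2 (P.ρ_sq_pos k))
    (mul_pos (Finset.prod_pos fun i _ => P.θ_pos i 0 1 (by decide))
      (Finset.prod_pos fun i _ => P.θ_pos i 2 3 (by decide)))

lemma weightA_pos : 0 < P.weightA :=
  div_pos (Finset.prod_pos fun i _ => P.θ_pos i 2 3 (by decide)) P.κ₁_pos

lemma weightB_pos : 0 < P.weightB :=
  div_pos (Finset.prod_pos fun i _ => P.θ_pos i 0 1 (by decide)) P.κ₂_pos

/-- The weighted inner product, conjugate linear in the first argument;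
`inner ℂ (F.1 k) (G.1 k)` is the integral of `conj f * g` over the `k`-th piece. -/
def innerH (F G : P.H) : ℂ :=
  ∑ k, (P.weight k : ℂ) * inner ℂ (F.1 k) (G.1 k)
    + (P.weightA : ℂ) * (starRingEnd ℂ F.2.1 * G.2.1)
    + (P.weightB : ℂ) * (starRingEnd ℂ F.2.2 * G.2.2)

lemma innerH_self (F : P.H) : P.innerH F F =
    ((∑ k, P.weight k * ‖F.1 k‖ ^ 2 + P.weightA * ‖F.2.1‖ ^ 2 + P.weightB * ‖F.2.2‖ ^ 2 : ℝ) :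
      ℂ) := by
  simp only [innerH, inner_self_eq_norm_sq_to_K, Complex.conj_mul']
  push_cast
  rfl

/-- The laws of an inner product. -/
@[reducible]
def innerCore : InnerProductSpace.Core ℂ P.H where
  inner := P.innerH
  conj_inner_symm F G := by
    simp only [innerH, map_add, map_sum, map_mul, Complex.conj_ofReal, inner_conj_symm,
      Complex.conj_conj]
    simp only [mul_comm]
  re_inner_nonneg F := by
    have h1 := P.weightA_pos
    have h2 := P.weightB_pos
    have h3 : 0 ≤ ∑ k, P.weight k * ‖F.1 k‖ ^ 2 :=
      Finset.sum_nonneg fun k _ => mul_nonneg (P.weight_pos k).le (sq_nonneg _)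
    change 0 ≤ RCLike.re (P.innerH F F)
    rw [innerH_self]
    simp only [RCLike.re_to_complex, Complex.ofReal_re]
    positivity
  add_left F G K := by
    change ∑ k, (P.weight k : ℂ) * inner ℂ (F.1 k + G.1 k) (K.1 k)
      + (P.weightA : ℂ) * (starRingEnd ℂ (F.2.1 + G.2.1) * K.2.1)
      + (P.weightB : ℂ) * (starRingEnd ℂ (F.2.2 + G.2.2) * K.2.2) = P.innerH F K + P.innerH G K
    simp only [innerH, inner_add_left, map_add, mul_add, add_mul, Finset.sum_add_distrib]
    ring
  smul_left F G r := by
    change ∑ k, (P.weight k : ℂ) * inner ℂ (r • F.1 k) (G.1 k)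
      + (P.weightA : ℂ) * (starRingEnd ℂ (r * F.2.1) * G.2.1)
      + (P.weightB : ℂ) * (starRingEnd ℂ (r * F.2.2) * G.2.2) = starRingEnd ℂ r * P.innerH F G
    simp only [innerH, inner_smul_left, map_mul, mul_add, Finset.mul_sum]
    congr 1
    · congr 1
      · exact Finset.sum_congr rfl fun k _ => by ring
      · ring
    · ring
  definite F h := by
    have h1 := P.weightA_pos
    have h2 := P.weightB_pos
    have h3 : ∀ k ∈ Finset.univ, 0 ≤ P.weight k * ‖F.1 k‖ ^ 2 :=
      fun k _ => mul_nonneg (P.weight_pos k).le (sq_nonneg _)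
    have h3' := Finset.sum_nonneg h3
    have h4 : 0 ≤ P.weightA * ‖F.2.1‖ ^ 2 := by positivity
    have h5 : 0 ≤ P.weightB * ‖F.2.2‖ ^ 2 := by positivity
    change P.innerH F F = 0 at h
    rw [innerH_self, Complex.ofReal_eq_zero] at h
    have e1 : P.weightA * ‖F.2.1‖ ^ 2 = 0 := by linarith
    have e2 : P.weightB * ‖F.2.2‖ ^ 2 = 0 := by linarith
    have e3 : ∑ k, P.weight k * ‖F.1 k‖ ^ 2 = 0 := by linarith
    rw [Finset.sum_eq_zero_iff_of_nonneg h3] at e3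
    refine Prod.ext (funext fun k => ?_) (Prod.ext ?_ ?_)
    · have := e3 k (Finset.mem_univ k)
      exact norm_eq_zero.1 (by simpa [(P.weight_pos k).ne'] using this)
    · exact norm_eq_zero.1 (by simpa [h1.ne'] using e1)
    · exact norm_eq_zero.1 (by simpa [h2.ne'] using e2)

instance : NormedAddCommGroup P.H := P.innerCore.toNormedAddCommGroup

instance : InnerProductSpace ℂ P.H := InnerProductSpace.ofCore P.innerCore.toCore

/-! ### The operator -/

/-- `f ∈ AC_loc(c, d)`: absolutely continuous on every compact subinterval of `(c, d)`. -/
def ACLoc (f : ℝ → ℂ) (c d : ℝ) : Prop :=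
  ∀ x ∈ Ioo c d, ∀ y ∈ Ioo c d, AbsolutelyContinuousOnInterval f x y

/-- The differential expression `-ρ u'' + q u` on the `k`-th piece. -/
def ell (k : Fin (n + 1)) (f : ℝ → ℂ) (x : ℝ) : ℂ :=
  -((P.ρ k ^ 2 : ℝ) : ℂ) * deriv (deriv f) x + (P.q x : ℂ) * f x

/-- First transmission functional at the `i`-th interior point. -/
def trans₁ (i : Fin n) (f : ℝ → ℂ) : ℂ :=
  P.δm1 i * Function.leftLim (deriv f) (P.node i) + P.δm0 i * Function.leftLim f (P.node i)
    + P.δp1 i * Function.rightLim (deriv f) (P.node i) + P.δp0 i * Function.rightLim f (P.node i)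

/-- Second transmission functional at the `i`-th interior point. -/
def trans₂ (i : Fin n) (f : ℝ → ℂ) : ℂ :=
  P.γm1 i * Function.leftLim (deriv f) (P.node i) + P.γm0 i * Function.leftLim f (P.node i)
    + P.γp1 i * Function.rightLim (deriv f) (P.node i) + P.γp0 i * Function.rightLim f (P.node i)

/-- Boundary functional `B_a`; the values at the end points are the one-sided limits. -/
def Ba (f : ℝ → ℂ) : ℂ :=
  P.δ₁ * Function.rightLim f P.a - P.δ₂ * Function.rightLim (deriv f) P.a

/-- Boundary functional `B'_a`. -/
def Ba' (f : ℝ → ℂ) : ℂ :=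
  P.δ₃ * Function.rightLim f P.a - P.δ₄ * Function.rightLim (deriv f) P.a

/-- Boundary functional `B_b`. -/
def Bb (f : ℝ → ℂ) : ℂ :=
  P.γ₁ * Function.leftLim f P.b - P.γ₂ * Function.leftLim (deriv f) P.b

/-- Boundary functional `B'_b`. -/
def Bb' (f : ℝ → ℂ) : ℂ :=
  P.γ₃ * Function.leftLim f P.b - P.γ₄ * Function.leftLim (deriv f) P.b

/-- The functions which occur as first components of elements of the domain of the operator.
Only the restriction of `f` to the union of the open pieces matters. -/
structure Admissible (f : ℝ → ℂ) : Prop where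
  differentiableOn : ∀ k, DifferentiableOn ℝ f (P.piece k)
  acLoc : ∀ k : Fin (n + 1), ACLoc f (P.ξ k.castSucc) (P.ξ k.succ)
  acLoc_deriv : ∀ k : Fin (n + 1), ACLoc (deriv f) (P.ξ k.castSucc) (P.ξ k.succ)
  right_limit : ∀ k : Fin (n + 1), ∃ l : ℂ, Tendsto f (𝓝[>] (P.ξ k.castSucc)) (𝓝 l)
  left_limit : ∀ k : Fin (n + 1), ∃ l : ℂ, Tendsto f (𝓝[<] (P.ξ k.succ)) (𝓝 l)
  right_limit_deriv : ∀ k : Fin (n + 1),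
    ∃ l : ℂ, Tendsto (deriv f) (𝓝[>] (P.ξ k.castSucc)) (𝓝 l)
  left_limit_deriv : ∀ k : Fin (n + 1),
    ∃ l : ℂ, Tendsto (deriv f) (𝓝[<] (P.ξ k.succ)) (𝓝 l)
  memLp_ell : ∀ k, MemLp (P.ell k f) 2 (volume.restrict (P.piece k))
  trans₁_eq : ∀ i, P.trans₁ i f = 0
  trans₂_eq : ∀ i, P.trans₂ i f = 0

/-- `F = (f, B'_a[f], -B'_b[f])` and `G = (ℓ f, B_a[f], B_b[f])` for the function `f`. -/
structure Represents (f : ℝ → ℂ) (F G : P.H) : Prop where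
  admissible : P.Admissible f
  fst_eq : ∀ k, F.1 k =ᵐ[volume.restrict (P.piece k)] f
  fst_a : F.2.1 = P.Ba' f
  fst_b : F.2.2 = -P.Bb' f
  snd_eq : ∀ k, G.1 k =ᵐ[volume.restrict (P.piece k)] P.ell k f
  snd_a : G.2.1 = P.Ba f
  snd_b : G.2.2 = P.Bb f

lemma eventually_piece_right (k : Fin (n + 1)) :
    ∀ᶠ x in 𝓝[>] (P.ξ k.castSucc), x ∈ P.piece k :=
  Ioo_mem_nhdsGT (P.ξ_strictMono Fin.castSucc_lt_succ)

lemma eventually_piece_left (k : Fin (n + 1)) :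
    ∀ᶠ x in 𝓝[<] (P.ξ k.succ), x ∈ P.piece k :=
  Ioo_mem_nhdsLT (P.ξ_strictMono Fin.castSucc_lt_succ)

lemma isOpen_piece (k : Fin (n + 1)) : IsOpen (P.piece k) := isOpen_Ioo

lemma a_eq : P.a = P.ξ (Fin.castSucc 0) := rfl

lemma b_eq : P.b = P.ξ (Fin.last n).succ := rfl

lemma node_eq (i : Fin n) : P.node i = P.ξ i.castSucc.succ := rfl

lemma ACLoc.ae_differentiableAt {f : ℝ → ℂ} {c d : ℝ} (hf : ACLoc f c d) :
    ∀ᵐ x ∂(volume.restrict (Ioo c d)), DifferentiableAt ℝ f x := by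
  have h : LocallyBoundedVariationOn f (Ioo c d) := fun x y hx hy =>
    ((hf x hx y hy).boundedVariationOn).mono (inter_subset_right.trans Icc_subset_uIcc)
  rw [ae_restrict_iff' measurableSet_Ioo]
  filter_upwards [h.ae_differentiableWithinAt_of_mem] with x hx hxm
  exact (hx hxm).differentiableAt (Ioo_mem_nhds hxm.1 hxm.2)

section lin

variable {P} {f g : ℝ → ℂ}

lemma Admissible.differentiableAt (hf : P.Admissible f) {k : Fin (n + 1)} {x : ℝ}
    (hx : x ∈ P.piece k) : DifferentiableAt ℝ f x :=
  (hf.differentiableOn k).differentiableAt ((P.isOpen_piece k).mem_nhds hx)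

lemma Admissible.deriv_lin (hf : P.Admissible f) (hg : P.Admissible g) (c : ℂ)
    {k : Fin (n + 1)} {x : ℝ} (hx : x ∈ P.piece k) :
    deriv (c • f + g) x = (c • deriv f + deriv g) x := by
  rw [deriv_add ((hf.differentiableAt hx).const_smul c) (hg.differentiableAt hx),
    deriv_const_smul c (hf.differentiableAt hx)]
  rfl

lemma Admissible.ell_lin (hf : P.Admissible f) (hg : P.Admissible g) (c : ℂ) (k : Fin (n + 1)) :
    P.ell k (c • f + g) =ᵐ[volume.restrict (P.piece k)] c • P.ell k f + P.ell k g := by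
  filter_upwards [(hf.acLoc_deriv k).ae_differentiableAt, (hg.acLoc_deriv k).ae_differentiableAt,
    ae_restrict_mem measurableSet_Ioo] with x hx hy hxm
  have h1 : deriv (c • f + g) =ᶠ[𝓝 x] c • deriv f + deriv g := by
    filter_upwards [(P.isOpen_piece k).mem_nhds hxm] with y hy
    exact hf.deriv_lin hg c hy
  have h2 : deriv (deriv (c • f + g)) x = c * deriv (deriv f) x + deriv (deriv g) x := by
    rw [h1.deriv_eq, deriv_add (hx.const_smul c) hy, deriv_const_smul c hx]
    rfl
  simp only [ell, h2, Pi.add_apply, Pi.smul_apply, smul_eq_mul]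
  ring

lemma tendsto_lin {l : Filter ℝ} {u v : ℂ} (hf : Tendsto f l (𝓝 u)) (hg : Tendsto g l (𝓝 v))
    (c : ℂ) : Tendsto (c • f + g) l (𝓝 (c * u + v)) :=
  (hf.const_mul c).add hg

lemma rightLim_lin {x₀ : ℝ} (hf : ∃ l, Tendsto f (𝓝[>] x₀) (𝓝 l)) (hg : ∃ l, Tendsto g (𝓝[>] x₀) (𝓝 l))
    (c : ℂ) {h : ℝ → ℂ} (hh : h =ᶠ[𝓝[>] x₀] c • f + g) :
    Tendsto h (𝓝[>] x₀) (𝓝 (c * Function.rightLim f x₀ + Function.rightLim g x₀)) ∧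
    Function.rightLim h x₀ = c * Function.rightLim f x₀ + Function.rightLim g x₀ := by
  obtain ⟨u, hu⟩ := hf
  obtain ⟨v, hv⟩ := hg
  have := (tendsto_lin hu hv c).congr' hh.symm
  rw [rightLim_eq_of_tendsto hu, rightLim_eq_of_tendsto hv,
    rightLim_eq_of_tendsto this]
  exact ⟨this, rfl⟩

lemma leftLim_lin {x₀ : ℝ} (hf : ∃ l, Tendsto f (𝓝[<] x₀) (𝓝 l)) (hg : ∃ l, Tendsto g (𝓝[<] x₀) (𝓝 l))
    (c : ℂ) {h : ℝ → ℂ} (hh : h =ᶠ[𝓝[<] x₀] c • f + g) :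
    Tendsto h (𝓝[<] x₀) (𝓝 (c * Function.leftLim f x₀ + Function.leftLim g x₀)) ∧
    Function.leftLim h x₀ = c * Function.leftLim f x₀ + Function.leftLim g x₀ := by
  obtain ⟨u, hu⟩ := hf
  obtain ⟨v, hv⟩ := hg
  have := (tendsto_lin hu hv c).congr' hh.symm
  rw [leftLim_eq_of_tendsto hu, leftLim_eq_of_tendsto hv,
    leftLim_eq_of_tendsto this]
  exact ⟨this, rfl⟩

lemma Admissible.right_lin (hf : P.Admissible f) (hg : P.Admissible g) (c : ℂ) (k : Fin (n + 1)) :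
    Tendsto (c • f + g) (𝓝[>] (P.ξ k.castSucc))
      (𝓝 (c * Function.rightLim f (P.ξ k.castSucc) + Function.rightLim g (P.ξ k.castSucc))) ∧
    Function.rightLim (c • f + g) (P.ξ k.castSucc) =
      c * Function.rightLim f (P.ξ k.castSucc) + Function.rightLim g (P.ξ k.castSucc) :=
  rightLim_lin (hf.right_limit k) (hg.right_limit k) c (EventuallyEq.refl _ (c • f + g))

lemma Admissible.left_lin (hf : P.Admissible f) (hg : P.Admissible g) (c : ℂ) (k : Fin (n + 1)) :
    Tendsto (c • f + g) (𝓝[<] (P.ξ k.succ))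
      (𝓝 (c * Function.leftLim f (P.ξ k.succ) + Function.leftLim g (P.ξ k.succ))) ∧
    Function.leftLim (c • f + g) (P.ξ k.succ) =
      c * Function.leftLim f (P.ξ k.succ) + Function.leftLim g (P.ξ k.succ) :=
  leftLim_lin (hf.left_limit k) (hg.left_limit k) c (EventuallyEq.refl _ (c • f + g))

lemma Admissible.right_deriv_lin (hf : P.Admissible f) (hg : P.Admissible g) (c : ℂ)
    (k : Fin (n + 1)) :
    Tendsto (deriv (c • f + g)) (𝓝[>] (P.ξ k.castSucc))
      (𝓝 (c * Function.rightLim (deriv f) (P.ξ k.castSucc) + Function.rightLim (deriv g) (P.ξ k.castSucc))) ∧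
    Function.rightLim (deriv (c • f + g)) (P.ξ k.castSucc) =
      c * Function.rightLim (deriv f) (P.ξ k.castSucc) + Function.rightLim (deriv g) (P.ξ k.castSucc) :=
  rightLim_lin (hf.right_limit_deriv k) (hg.right_limit_deriv k) c (h := deriv (c • f + g))
    ((P.eventually_piece_right k).mono fun _ hx => hf.deriv_lin hg c hx)

lemma Admissible.left_deriv_lin (hf : P.Admissible f) (hg : P.Admissible g) (c : ℂ)
    (k : Fin (n + 1)) :
    Tendsto (deriv (c • f + g)) (𝓝[<] (P.ξ k.succ))
      (𝓝 (c * Function.leftLim (deriv f) (P.ξ k.succ) + Function.leftLim (deriv g) (P.ξ k.succ))) ∧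
    Function.leftLim (deriv (c • f + g)) (P.ξ k.succ) =
      c * Function.leftLim (deriv f) (P.ξ k.succ) + Function.leftLim (deriv g) (P.ξ k.succ) :=
  leftLim_lin (hf.left_limit_deriv k) (hg.left_limit_deriv k) c (h := deriv (c • f + g))
    ((P.eventually_piece_left k).mono fun _ hx => hf.deriv_lin hg c hx)

lemma ACLoc.congr {c d : ℝ} (hf : ACLoc f c d) (h : EqOn f g (Ioo c d)) : ACLoc g c d := by
  intro x hx y hy
  have hs : uIcc x y ⊆ Ioo c d := ordConnected_Ioo.uIcc_subset hx hy
  refine (hf x hx y hy).congr' ?_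
  filter_upwards [mem_inf_of_right (mem_principal_self _)] with E hE
  refine Finset.sum_congr rfl fun i hi => ?_
  rw [h (hs (hE.1 i hi).1), h (hs (hE.1 i hi).2)]

lemma ACLoc.lin {d e : ℝ} (hf : ACLoc f d e) (hg : ACLoc g d e) (c : ℂ) :
    ACLoc (c • f + g) d e := fun x hx y hy =>
  ((hf x hx y hy).const_smul c).add (hg x hx y hy)

lemma Admissible.lin (hf : P.Admissible f) (hg : P.Admissible g) (c : ℂ) :
    P.Admissible (c • f + g) where
  differentiableOn k := ((hf.differentiableOn k).const_smul c).add (hg.differentiableOn k)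
  acLoc k := (hf.acLoc k).lin (hg.acLoc k) c
  acLoc_deriv k := ((hf.acLoc_deriv k).lin (hg.acLoc_deriv k) c).congr
    fun _ hx => (hf.deriv_lin hg c (k := k) hx).symm
  right_limit k := ⟨_, (hf.right_lin hg c k).1⟩
  left_limit k := ⟨_, (hf.left_lin hg c k).1⟩
  right_limit_deriv k := ⟨_, (hf.right_deriv_lin hg c k).1⟩
  left_limit_deriv k := ⟨_, (hf.left_deriv_lin hg c k).1⟩
  memLp_ell k := (memLp_congr_ae (hf.ell_lin hg c k)).2
    (((hf.memLp_ell k).const_smul c).add (hg.memLp_ell k))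
  trans₁_eq i := by
    have h1 := hf.trans₁_eq i
    have h2 := hg.trans₁_eq i
    have e1 := (hf.left_lin hg c i.castSucc).2
    have e2 := (hf.left_deriv_lin hg c i.castSucc).2
    have e3 := (hf.right_lin hg c i.succ).2
    have e4 := (hf.right_deriv_lin hg c i.succ).2
    rw [← node_eq] at e1 e2
    change Function.rightLim _ (P.node i) = c * Function.rightLim _ (P.node i)
      + Function.rightLim _ (P.node i) at e3 e4
    rw [trans₁] at *
    rw [e1, e2, e3, e4]
    linear_combination c * h1 + h2
  trans₂_eq i := by
    have h1 := hf.trans₂_eq i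
    have h2 := hg.trans₂_eq i
    have e1 := (hf.left_lin hg c i.castSucc).2
    have e2 := (hf.left_deriv_lin hg c i.castSucc).2
    have e3 := (hf.right_lin hg c i.succ).2
    have e4 := (hf.right_deriv_lin hg c i.succ).2
    rw [← node_eq] at e1 e2
    change Function.rightLim _ (P.node i) = c * Function.rightLim _ (P.node i)
      + Function.rightLim _ (P.node i) at e3 e4
    rw [trans₂] at *
    rw [e1, e2, e3, e4]
    linear_combination c * h1 + h2

lemma Represents.lin {F G F' G' : P.H} (hf : P.Represents f F G) (hg : P.Represents g F' G')
    (c : ℂ) : P.Represents (c • f + g) (c • F + F') (c • G + G') := by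
  have e1 := (hf.admissible.right_lin hg.admissible c 0).2
  have e2 := (hf.admissible.right_deriv_lin hg.admissible c 0).2
  have e3 := (hf.admissible.left_lin hg.admissible c (Fin.last n)).2
  have e4 := (hf.admissible.left_deriv_lin hg.admissible c (Fin.last n)).2
  rw [← a_eq] at e1 e2
  rw [← b_eq] at e3 e4
  refine ⟨hf.admissible.lin hg.admissible c, fun k => ?_, ?_, ?_, fun k => ?_, ?_, ?_⟩
  · change (c • F.1 k + F'.1 k : Lp ℂ 2 (volume.restrict (P.piece k))) =ᵐ[_] _
    filter_upwards [Lp.coeFn_add (c • F.1 k) (F'.1 k), Lp.coeFn_smul c (F.1 k), hf.fst_eq k,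
      hg.fst_eq k] with x h1 h2 h3 h4
    rw [h1, Pi.add_apply, h2, Pi.smul_apply, h3, h4]
    rfl
  · change c * F.2.1 + F'.2.1 = _
    rw [hf.fst_a, hg.fst_a]
    simp only [Ba', e1, e2]
    ring
  · change c * F.2.2 + F'.2.2 = _
    rw [hf.fst_b, hg.fst_b]
    simp only [Bb', e3, e4]
    ring
  · change (c • G.1 k + G'.1 k : Lp ℂ 2 (volume.restrict (P.piece k))) =ᵐ[_] _
    filter_upwards [Lp.coeFn_add (c • G.1 k) (G'.1 k), Lp.coeFn_smul c (G.1 k), hf.snd_eq k,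
      hg.snd_eq k, hf.admissible.ell_lin hg.admissible c k] with x h1 h2 h3 h4 h5
    rw [h1, Pi.add_apply, h2, Pi.smul_apply, h3, h4, h5]
    rfl
  · change c * G.2.1 + G'.2.1 = _
    rw [hf.snd_a, hg.snd_a]
    simp only [Ba, e1, e2]
    ring
  · change c * G.2.2 + G'.2.2 = _
    rw [hf.snd_b, hg.snd_b]
    simp only [Bb, e3, e4]
    ring

lemma represents_zero : P.Represents 0 0 0 := by
  have hd : deriv (0 : ℝ → ℂ) = 0 := funext fun x => deriv_const x 0
  have hl : ∀ x, Function.leftLim (0 : ℝ → ℂ) x = 0 := fun x =>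
    leftLim_eq_of_tendsto tendsto_const_nhds
  have hr : ∀ x, Function.rightLim (0 : ℝ → ℂ) x = 0 := fun x =>
    rightLim_eq_of_tendsto tendsto_const_nhds
  have hac : ∀ c d, ACLoc 0 c d := fun c d x _ y _ => by
    simp [AbsolutelyContinuousOnInterval, tendsto_const_nhds]
  have hell : ∀ k, P.ell k 0 = 0 := fun k => funext fun x => by simp [ell, hd]
  refine ⟨⟨fun k => differentiableOn_const 0, fun k => hac _ _, fun k => by rw [hd]; exact hac _ _,
    fun k => ⟨0, tendsto_const_nhds⟩, fun k => ⟨0, tendsto_const_nhds⟩,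
    fun k => ⟨0, by rw [hd]; exact tendsto_const_nhds⟩, fun k => ⟨0, by rw [hd]; exact tendsto_const_nhds⟩,
    fun k => by rw [hell]; exact MemLp.zero, fun i => ?_, fun i => ?_⟩, fun k => ?_, ?_, ?_,
    fun k => ?_, ?_, ?_⟩
  · simp [trans₁, hd, hl, hr]
  · simp [trans₂, hd, hl, hr]
  · exact Lp.coeFn_zero _ _ _
  · simp only [Ba', hd, hr, mul_zero, sub_zero]; rfl
  · simp only [Bb', hd, hl, mul_zero, sub_zero, neg_zero]; rfl
  · rw [hell]; exact Lp.coeFn_zero _ _ _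
  · simp only [Ba, hd, hr, mul_zero, sub_zero]; rfl
  · simp only [Bb, hd, hl, mul_zero, sub_zero]; rfl

/-- The second entry of a represented pair is determined by the first. -/
lemma Represents.eq_zero {G : P.H} (hf : P.Represents f 0 G) : G = 0 := by
  have h0 : ∀ k, EqOn f 0 (P.piece k) := fun k =>
    Measure.eqOn_open_of_ae_eq ((hf.fst_eq k).symm.trans (Lp.coeFn_zero _ _ _))
      (P.isOpen_piece k) (hf.admissible.differentiableOn k).continuousOn continuousOn_const
  have h1 : ∀ k, EqOn (deriv f) 0 (P.piece k) := fun k x hx => by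
    have : f =ᶠ[𝓝 x] fun _ => 0 := (h0 k).eventuallyEq_of_mem ((P.isOpen_piece k).mem_nhds hx)
    rw [this.deriv_eq]
    simp
  have h2 : ∀ k, EqOn (deriv (deriv f)) 0 (P.piece k) := fun k x hx => by
    have : deriv f =ᶠ[𝓝 x] fun _ => 0 :=
      (h1 k).eventuallyEq_of_mem ((P.isOpen_piece k).mem_nhds hx)
    rw [this.deriv_eq]
    simp
  have hr : ∀ u : ℝ → ℂ, EqOn u 0 (P.piece 0) → Function.rightLim u P.a = 0 := fun u hu =>
    rightLim_eq_of_tendsto (tendsto_const_nhds.congr'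
      ((P.eventually_piece_right 0).mono fun x hx => (hu hx).symm))
  have hl : ∀ u : ℝ → ℂ, EqOn u 0 (P.piece (Fin.last n)) → Function.leftLim u P.b = 0 :=
    fun u hu => leftLim_eq_of_tendsto (tendsto_const_nhds.congr'
      ((P.eventually_piece_left (Fin.last n)).mono fun x hx => (hu hx).symm))
  refine Prod.ext (funext fun k => Lp.ext ?_) (Prod.ext ?_ ?_)
  · refine (hf.snd_eq k).trans (EventuallyEq.trans ?_ (Lp.coeFn_zero _ _ _).symm)
    filter_upwards [ae_restrict_mem measurableSet_Ioo] with x hx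
    simp [ell, h0 k hx, h2 k hx]
  · rw [hf.snd_a, Ba, hr _ (h0 _), hr _ (h1 _)]
    simp only [mul_zero, sub_zero]; rfl
  · rw [hf.snd_b, Bb, hl _ (h0 _), hl _ (h1 _)]
    simp only [mul_zero, sub_zero]; rfl

end lin

/-- The graph of the operator: all pairs `((f, B'_a[f], -B'_b[f]), (ℓ f, B_a[f], B_b[f]))` with
`f` admissible. -/
def opGraph : Submodule ℂ (P.H × P.H) where
  carrier := {p | ∃ f : ℝ → ℂ, P.Represents f p.1 p.2}
  zero_mem' := ⟨0, represents_zero⟩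
  add_mem' := by
    rintro p p' ⟨f, hf⟩ ⟨g, hg⟩
    exact ⟨(1 : ℂ) • f + g, by simpa only [one_smul, Prod.fst_add, Prod.snd_add] using hf.lin hg 1⟩
  smul_mem' := by
    rintro c p ⟨f, hf⟩
    exact ⟨c • f + 0, by simpa only [add_zero, Prod.smul_fst, Prod.smul_snd] using hf.lin represents_zero c⟩

/-- The operator `(f, B'_a[f], -B'_b[f]) ↦ (ℓ f, B_a[f], B_b[f])` in `H`, defined for all
admissible `f`. -/
def op : P.H →ₗ.[ℂ] P.H := P.opGraph.toLinearPMap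

lemma op_graph : P.op.graph = P.opGraph := by
  refine Submodule.toLinearPMap_graph_eq _ ?_
  rintro ⟨F, G⟩ ⟨f, hf⟩ hF
  obtain rfl : F = 0 := hF
  exact hf.eq_zero

lemma mem_op_domain_iff (F : P.H) : F ∈ P.op.domain ↔
    ∃ f : ℝ → ℂ, P.Admissible f ∧ (∀ k, F.1 k =ᵐ[volume.restrict (P.piece k)] f) ∧
      F.2.1 = P.Ba' f ∧ F.2.2 = -P.Bb' f := by
  rw [LinearPMap.mem_domain_iff, op_graph]
  constructor
  · rintro ⟨G, f, hf⟩
    exact ⟨f, hf.admissible, hf.fst_eq, hf.fst_a, hf.fst_b⟩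
  · rintro ⟨f, h1, h2, h3, h4⟩
    exact ⟨⟨fun k => (h1.memLp_ell k).toLp _, P.Ba f, P.Bb f⟩, f, h1, h2, h3, h4,
      fun k => (h1.memLp_ell k).coeFn_toLp, rfl, rfl⟩

end BVTP

namespace LinearPMap

variable {E : Type*} [NormedAddCommGroup E] [NormedSpace ℂ E]

/-- The point spectrum: the set of eigenvalues. -/
def pointSpectrum (A : E →ₗ.[ℂ] E) : Set ℂ :=
  {z | ∃ F : A.domain, (F : E) ≠ 0 ∧ A F = z • (F : E)}

/-- `T` is the resolvent `(A - z I)⁻¹`: a bounded operator on the whole space that maps into the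
domain of `A` and is a two-sided inverse of `A - z I : A.domain → E`. -/
def IsResolventAt (A : E →ₗ.[ℂ] E) (z : ℂ) (T : E →L[ℂ] E) : Prop :=
  (∀ G : E, ∃ h : T G ∈ A.domain, A ⟨T G, h⟩ - z • T G = G) ∧
    ∀ F : A.domain, T (A F - z • (F : E)) = F

end LinearPMap

end

/-!
The problem `(R - z) F = G` is a linear boundary value problem for a second-order equation on each
piece. Integrating from the left end point of each piece turns it into integral equations for `f`
and `f'`, and the `2 (n + 1)` initial values which they leave open are coupled by as many boundary
and transmission conditions. Absorbing these conditions into the initial values, one gets a single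
fixed point equation `w = M (w, G)` for `w = (f, f')` in a space of continuous functions. By
Arzelà-Ascoli integration is compact from `L²` to continuous functions, hence so is `M`. If `z` is
not an eigenvalue, `w = M (w, 0)` has only the zero solution, and the Fredholm alternative gives a
compact solution operator `G ↦ w`; following it by the bounded map `w ↦ F` gives the resolvent.
-/

open scoped ENNReal BoundedContinuousFunction

noncomputable section

section CompactOperator

variable {X : Type*} [TopologicalSpace X] [Zero X]

theorem isCompactOperator_prodMk {Y Z : Type*} [TopologicalSpace Y] [TopologicalSpace Z]
    {f : X → Y} {g : X → Z} (hf : IsCompactOperator f) (hg : IsCompactOperator g) :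
    IsCompactOperator fun x => (f x, g x) := by
  obtain ⟨K, hK, hfK⟩ := hf
  obtain ⟨L, hL, hgL⟩ := hg
  exact ⟨K ×ˢ L, hK.prod hL, mem_of_superset (inter_mem hfK hgL) fun _ hx => hx⟩

theorem isCompactOperator_pi {ι : Type*} [Finite ι] {Y : ι → Type*}
    [∀ i, TopologicalSpace (Y i)] {f : ∀ i, X → Y i} (hf : ∀ i, IsCompactOperator (f i)) :
    IsCompactOperator fun x i => f i x := by
  choose K hK hfK using hf
  exact ⟨univ.pi K, isCompact_univ_pi hK,
    mem_of_superset (iInter_mem.2 hfK) fun x hx i _ => mem_iInter.1 hx i⟩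

end CompactOperator

theorem exists_isCompactOperator_fixedPoint {𝕜 X E : Type*} [NontriviallyNormedField 𝕜]
    [NormedAddCommGroup X] [NormedSpace 𝕜 X] [CompleteSpace X]
    [NormedAddCommGroup E] [NormedSpace 𝕜 E] {M : X × E →L[𝕜] X} (hM : IsCompactOperator M)
    (h0 : ∀ x, M (x, 0) = x → x = 0) :
    ∃ S : E →L[𝕜] X, IsCompactOperator S ∧ ∀ y, M (S y, y) = S y := by
  set K : X →L[𝕜] X := M.comp (.inl 𝕜 X E)
  set B : E →L[𝕜] X := M.comp (.inr 𝕜 X E)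
  have one_mem_resolventSet : (1 : 𝕜) ∈ resolventSet 𝕜 K := by
    have hK : IsCompactOperator K := hM.comp_clm _
    refine (hK.hasEigenvalue_or_mem_resolventSet one_ne_zero).resolve_left fun h => ?_
    obtain ⟨x, hx⟩ := h.exists_hasEigenvector
    exact hx.2 (h0 x (hx.apply_eq_smul.trans (one_smul 𝕜 x)))
  rw [spectrum.mem_resolventSet_iff, map_one] at one_mem_resolventSet
  obtain ⟨R, hR⟩ := one_mem_resolventSet.exists_right_inv
  have sub_apply_eq (y : E) : R (B y) - K (R (B y)) = B y := DFunLike.congr_fun hR (B y)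
  refine ⟨R.comp B, (hM.comp_clm (.inr 𝕜 X E)).clm_comp R, fun y => ?_⟩
  calc M (R (B y), y) = K (R (B y)) + B y := by
        rw [← Prod.fst_add_snd (R (B y), y), map_add]; rfl
    _ = R (B y) := by rw [← eq_sub_iff_add_eq', sub_apply_eq]

section Resolvent

variable {E : Type*} [NormedAddCommGroup E] [NormedSpace ℂ E] {A : E →ₗ.[ℂ] E} {z : ℂ}

theorem eq_zero_of_mem_graph_smul (hz : z ∉ A.pointSpectrum) {F : E}
    (hF : (F, z • F) ∈ A.graph) : F = 0 := by
  obtain ⟨F, rfl, hAF⟩ := A.mem_graph_iff.1 hF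
  by_contra hne
  exact hz ⟨F, hne, hAF⟩

theorem isResolventAt_of_mem_graph (hz : z ∉ A.pointSpectrum) {T : E →L[ℂ] E}
    (hT : ∀ G, (T G, G + z • T G) ∈ A.graph) : A.IsResolventAt z T := by
  refine ⟨fun G => ?_, fun F => ?_⟩
  · obtain ⟨⟨_, hTG⟩, rfl, hAF⟩ := A.mem_graph_iff.1 (hT G)
    exact ⟨hTG, sub_eq_of_eq_add hAF⟩
  · set G : E := A F - z • (F : E) with hG
    have snd_eq : G + z • T G - A F = z • (T G - F) := by rw [hG, smul_sub]; abel
    have sub_mem := A.graph.sub_mem (hT G) (A.mem_graph F)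
    rw [Prod.mk_sub_mk, snd_eq] at sub_mem
    exact sub_eq_zero.1 (eq_zero_of_mem_graph_smul hz sub_mem)

end Resolvent

section AbsoluteContinuity

theorem absolutelyContinuousOnInterval_of_dist_le {X Y : Type*} [PseudoMetricSpace X]
    [PseudoMetricSpace Y] {f : ℝ → X} {g : ℝ → Y} {a b : ℝ}
    (hg : AbsolutelyContinuousOnInterval g a b)
    (h : ∀ x ∈ uIcc a b, ∀ y ∈ uIcc a b, dist (f x) (f y) ≤ dist (g x) (g y)) :
    AbsolutelyContinuousOnInterval f a b := by
  refine squeeze_zero' (Eventually.of_forall fun _ => Finset.sum_nonneg fun _ _ => dist_nonneg)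
    ?_ hg
  filter_upwards [mem_inf_of_right (mem_principal_self _)] with E hE
  exact Finset.sum_le_sum fun i hi => h _ (hE.1 i hi).1 _ (hE.1 i hi).2

theorem absolutelyContinuousOnInterval_integral {E : Type*} [NormedAddCommGroup E]
    [NormedSpace ℝ E] {f : ℝ → E} {a b : ℝ} (hf : IntervalIntegrable f volume a b) :
    AbsolutelyContinuousOnInterval (fun x => ∫ t in a..x, f t) a b := by
  refine absolutelyContinuousOnInterval_of_dist_le
    (hf.norm.absolutelyContinuousOnInterval_intervalIntegral left_mem_uIcc) fun x hx y hy => ?_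
  have hfa {z : ℝ} (hz : z ∈ uIcc a b) : IntervalIntegrable f volume a z :=
    hf.mono_set (uIcc_subset_uIcc left_mem_uIcc hz)
  rw [dist_comm, dist_eq_norm, dist_comm, dist_eq_norm,
    intervalIntegral.integral_interval_sub_left (hfa hy) (hfa hx),
    intervalIntegral.integral_interval_sub_left (hfa hy).norm (hfa hx).norm]
  exact intervalIntegral.norm_integral_le_abs_integral_norm

end AbsoluteContinuity

theorem enorm_integral_le_eLpNorm_mul_rpow {α E : Type*} [MeasurableSpace α] {μ : Measure α}
    [NormedAddCommGroup E] [NormedSpace ℝ E] {f : α → E} {p : ℝ≥0∞} (hp : 1 ≤ p)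
    (hf : AEStronglyMeasurable f μ) :
    ‖∫ x, f x ∂μ‖ₑ ≤ eLpNorm f p μ * μ univ ^ (1 - 1 / p.toReal) :=
  calc ‖∫ x, f x ∂μ‖ₑ ≤ eLpNorm f 1 μ := by
        rw [eLpNorm_one_eq_lintegral_enorm]
        exact enorm_integral_le_lintegral_enorm f
    _ ≤ eLpNorm f p μ * μ univ ^ (1 - 1 / p.toReal) := by
        simpa only [ENNReal.toReal_one, div_one] using
          eLpNorm_le_eLpNorm_mul_rpow_measure_univ hp hf

theorem one_sub_one_div_toReal_pos {p : ℝ≥0∞} (hp : 1 < p) : 0 < 1 - 1 / p.toReal := by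
  rcases eq_or_ne p ∞ with rfl | hp_top
  · simp
  · have one_lt : 1 < p.toReal := by
      simpa only [ENNReal.toReal_one] using ENNReal.toReal_strict_mono hp_top hp
    rw [sub_pos, div_lt_one (one_pos.trans one_lt)]
    exact one_lt

theorem one_sub_one_div_toReal_nonneg {p : ℝ≥0∞} (hp : 1 ≤ p) : 0 ≤ 1 - 1 / p.toReal := by
  rcases hp.eq_or_lt with rfl | hp
  · simp
  · exact (one_sub_one_div_toReal_pos hp).le

section Interval

variable {𝕜 E : Type*} [NormedAddCommGroup E] {p : ℝ≥0∞} {c d : ℝ}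

section Integral

variable [NormedSpace ℝ E]

theorem intervalIntegral_congr_ae_restrict_Ioo {f g : ℝ → E}
    (hfg : f =ᵐ[volume.restrict (Ioo c d)] g) {x : ℝ} (hx : x ∈ Icc c d) :
    ∫ t in c..x, f t = ∫ t in c..x, g t := by
  rw [intervalIntegral.integral_of_le hx.1, intervalIntegral.integral_of_le hx.1,
    integral_Ioc_eq_integral_Ioo, integral_Ioc_eq_integral_Ioo]
  exact integral_congr_ae
    (ae_restrict_of_ae_restrict_of_subset (Ioo_subset_Ioo_right hx.2) hfg)

theorem integral_Lp_smul [NormedField 𝕜] [NormedSpace 𝕜 E] [SMulCommClass ℝ 𝕜 E]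
    (r : 𝕜) (g : Lp E p (volume.restrict (Ioo c d))) {x : ℝ} (hx : x ∈ Icc c d) :
    ∫ t in c..x, (r • g) t = r • ∫ t in c..x, g t := by
  rw [← intervalIntegral.integral_smul]
  exact intervalIntegral_congr_ae_restrict_Ioo (Lp.coeFn_smul r g) hx

end Integral

variable [Fact (1 ≤ p)]

section Integral

theorem intervalIntegrable_Lp (g : Lp E p (volume.restrict (Ioo c d))) {x y : ℝ}
    (hx : x ∈ Icc c d) (hy : y ∈ Icc c d) : IntervalIntegrable g volume x y := by
  have hcd : c ≤ d := hx.1.trans hx.2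
  have hg : IntervalIntegrable g volume c d := by
    rw [intervalIntegrable_iff_integrableOn_Ioo_of_le hcd]
    exact (Lp.memLp g).integrable Fact.out
  exact hg.mono_set (by rw [uIcc_of_le hcd]; exact ordConnected_Icc.uIcc_subset hx hy)

variable [NormedSpace ℝ E]

theorem integral_Lp_add (f g : Lp E p (volume.restrict (Ioo c d))) {x : ℝ} (hx : x ∈ Icc c d) :
    ∫ t in c..x, (f + g) t = (∫ t in c..x, f t) + ∫ t in c..x, g t := by
  have hc : c ∈ Icc c d := left_mem_Icc.2 (hx.1.trans hx.2)
  rw [← intervalIntegral.integral_add (intervalIntegrable_Lp f hc hx)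
    (intervalIntegrable_Lp g hc hx)]
  exact intervalIntegral_congr_ae_restrict_Ioo (Lp.coeFn_add f g) hx

theorem norm_intervalIntegral_Lp_le (g : Lp E p (volume.restrict (Ioo c d))) {x y : ℝ}
    (hx : x ∈ Icc c d) (hy : y ∈ Icc c d) :
    ‖∫ t in x..y, g t‖ ≤ dist x y ^ (1 - 1 / p.toReal) * ‖g‖ := by
  wlog hxy : x ≤ y generalizing x y
  · rw [intervalIntegral.integral_symm, norm_neg, dist_comm]
    exact this hy hx (le_of_not_ge hxy)
  have hp : 1 ≤ p := Fact.out
  have exponent_nonneg := one_sub_one_div_toReal_nonneg hp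
  have restrict_le : volume.restrict (Ioo x y) ≤ volume.restrict (Ioo c d) :=
    Measure.restrict_mono_set _ (Ioo_subset_Ioo hx.1 hy.2)
  have enorm_le : ‖∫ t in Ioo x y, g t‖ₑ ≤
      eLpNorm g p (volume.restrict (Ioo c d)) * ENNReal.ofReal (y - x) ^ (1 - 1 / p.toReal) := by
    refine (enorm_integral_le_eLpNorm_mul_rpow hp
      ((Lp.aestronglyMeasurable g).mono_measure restrict_le)).trans ?_
    rw [Measure.restrict_apply_univ, Real.volume_Ioo]
    gcongr
  rw [intervalIntegral.integral_of_le hxy, integral_Ioc_eq_integral_Ioo, dist_comm, Real.dist_eq,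
    abs_of_nonneg (sub_nonneg.2 hxy), mul_comm, Lp.norm_def, ← toReal_enorm,
    ← ENNReal.toReal_ofReal (Real.rpow_nonneg (sub_nonneg.2 hxy) _), ← ENNReal.toReal_mul,
    ← ENNReal.ofReal_rpow_of_nonneg (sub_nonneg.2 hxy) exponent_nonneg]
  exact ENNReal.toReal_mono (ENNReal.mul_ne_top (Lp.eLpNorm_ne_top g)
    (ENNReal.rpow_ne_top_of_nonneg exponent_nonneg ENNReal.ofReal_ne_top)) enorm_le

theorem dist_integral_Lp_le (g : Lp E p (volume.restrict (Ioo c d))) {x y : ℝ}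
    (hx : x ∈ Icc c d) (hy : y ∈ Icc c d) :
    dist (∫ t in c..x, g t) (∫ t in c..y, g t) ≤ dist x y ^ (1 - 1 / p.toReal) * ‖g‖ := by
  have hc : c ∈ Icc c d := left_mem_Icc.2 (hx.1.trans hx.2)
  rw [dist_eq_norm, intervalIntegral.integral_interval_sub_left (intervalIntegrable_Lp g hc hx)
    (intervalIntegrable_Lp g hc hy), dist_comm]
  exact norm_intervalIntegral_Lp_le g hy hx

theorem norm_add_integral_Lp_le (a : E) (g : Lp E p (volume.restrict (Ioo c d))) {x : ℝ}
    (hx : x ∈ Icc c d) :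
    ‖a + ∫ t in c..x, g t‖ ≤ (1 + (d - c) ^ (1 - 1 / p.toReal)) * ‖(a, g)‖ := by
  have hp : 1 ≤ p := Fact.out
  have dist_le : dist c x ≤ d - c := by
    rw [dist_comm, Real.dist_eq, abs_of_nonneg (sub_nonneg.2 hx.1)]
    exact sub_le_sub_right hx.2 c
  calc ‖a + ∫ t in c..x, g t‖
      ≤ ‖a‖ + dist c x ^ (1 - 1 / p.toReal) * ‖g‖ := norm_add_le_of_le le_rfl
        (norm_intervalIntegral_Lp_le g (left_mem_Icc.2 (hx.1.trans hx.2)) hx)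
    _ ≤ ‖(a, g)‖ + (d - c) ^ (1 - 1 / p.toReal) * ‖(a, g)‖ := by
        refine add_le_add (norm_fst_le (a, g)) (mul_le_mul ?_ (norm_snd_le (a, g))
          (norm_nonneg g) (Real.rpow_nonneg (dist_nonneg.trans dist_le) _))
        exact Real.rpow_le_rpow dist_nonneg dist_le (one_sub_one_div_toReal_nonneg hp)
    _ = _ := by ring

theorem continuousOn_integral_Lp (h : c ≤ d) (g : Lp E p (volume.restrict (Ioo c d))) :
    ContinuousOn (fun x => ∫ t in c..x, g t) (Icc c d) := by
  rw [← uIcc_of_le h]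
  exact intervalIntegral.continuousOn_primitive_interval'
    (intervalIntegrable_Lp g (left_mem_Icc.2 h) (right_mem_Icc.2 h)) left_mem_uIcc

end Integral

section ContToLp

variable [NormedField 𝕜] [NormedSpace 𝕜 E]

variable (𝕜 p) in
/-- The inclusion of the continuous functions on `[c, d]` into `Lp` of the open interval. It is
defined by way of the extension by constants, as `Lp` is built on functions on the line. -/
def contToLp (h : c ≤ d) : (Icc c d →ᵇ E) →L[𝕜] Lp E p (volume.restrict (Ioo c d)) :=
  (BoundedContinuousFunction.toLp p (volume.restrict (Ioo c d)) 𝕜).comp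
    ({ toFun := fun u => u.compContinuous ⟨projIcc c d h, continuous_projIcc⟩
       map_add' := fun _ _ => rfl
       map_smul' := fun _ _ => rfl
       cont := BoundedContinuousFunction.continuous_compContinuous _ } :
      (Icc c d →ᵇ E) →L[𝕜] (ℝ →ᵇ E))

theorem coeFn_contToLp (h : c ≤ d) (u : Icc c d →ᵇ E) :
    contToLp 𝕜 p h u =ᵐ[volume.restrict (Ioo c d)] IccExtend h u :=
  BoundedContinuousFunction.coeFn_toLp p (volume.restrict (Ioo c d)) 𝕜
    (u.compContinuous ⟨projIcc c d h, continuous_projIcc⟩)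

theorem continuous_IccExtend (h : c ≤ d) (u : Icc c d →ᵇ E) : Continuous (IccExtend h u) :=
  u.continuous.Icc_extend'

theorem contToLp_injective (h : c < d) :
    Function.Injective (contToLp 𝕜 p h.le : (Icc c d →ᵇ E) → _) := fun u v huv => by
  have extend_ae_eq : IccExtend h.le u =ᵐ[volume.restrict (Ioo c d)] IccExtend h.le v :=
    (coeFn_contToLp h.le u).symm.trans (huv ▸ coeFn_contToLp h.le v)
  have extend_eqOn : EqOn (IccExtend h.le u) (IccExtend h.le v) (Ioo c d) :=
    Measure.eqOn_open_of_ae_eq extend_ae_eq isOpen_Ioo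
      (continuous_IccExtend h.le u).continuousOn (continuous_IccExtend h.le v).continuousOn
  ext x
  have hx : (x : ℝ) ∈ closure (Ioo c d) := (closure_Ioo h.ne).symm ▸ x.2
  simpa only [IccExtend_val] using extend_eqOn.closure (continuous_IccExtend h.le u)
    (continuous_IccExtend h.le v) hx

theorem tendsto_nhdsGT_of_eqOn_IccExtend (h : c < d) {f : ℝ → E} {u : Icc c d →ᵇ E}
    (hf : EqOn f (IccExtend h.le u) (Ioo c d)) :
    Tendsto f (𝓝[>] c) (𝓝 (u ⟨c, left_mem_Icc.2 h.le⟩)) := by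
  rw [← IccExtend_left h.le u]
  exact (((continuous_IccExtend h.le u).tendsto c).mono_left nhdsWithin_le_nhds).congr'
    (hf.symm.eventuallyEq_of_mem (Ioo_mem_nhdsGT h))

theorem tendsto_nhdsLT_of_eqOn_IccExtend (h : c < d) {f : ℝ → E} {u : Icc c d →ᵇ E}
    (hf : EqOn f (IccExtend h.le u) (Ioo c d)) :
    Tendsto f (𝓝[<] d) (𝓝 (u ⟨d, right_mem_Icc.2 h.le⟩)) := by
  rw [← IccExtend_right h.le u]
  exact (((continuous_IccExtend h.le u).tendsto d).mono_left nhdsWithin_le_nhds).congr'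
    (hf.symm.eventuallyEq_of_mem (Ioo_mem_nhdsLT h))

end ContToLp

section Antideriv

variable [NormedSpace ℝ E] [NormedField 𝕜] [NormedSpace 𝕜 E] [SMulCommClass ℝ 𝕜 E]

variable (𝕜) in
/-- The antiderivative `x ↦ a + ∫ t in c..x, g t` with initial value `a` at `c`, as an operator
into the continuous functions on `[c, d]`. -/
def antideriv (h : c ≤ d) :
    E × Lp E p (volume.restrict (Ioo c d)) →L[𝕜] (Icc c d →ᵇ E) :=
  LinearMap.mkContinuous
    { toFun := fun ag => .mkOfCompact ⟨fun x => ag.1 + ∫ t in c..(x : ℝ), ag.2 t,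
        continuous_const.add (continuousOn_integral_Lp h ag.2).domRestrict⟩
      map_add' := fun (a, f) (b, g) => by
        ext x
        exact (congrArg (a + b + ·) (integral_Lp_add f g x.2)).trans (add_add_add_comm ..)
      map_smul' := fun r (a, g) => by
        ext x
        exact (congrArg (r • a + ·) (integral_Lp_smul r g x.2)).trans (smul_add ..).symm }
    (1 + (d - c) ^ (1 - 1 / p.toReal)) fun (a, g) =>
      (BoundedContinuousFunction.norm_le (by have := sub_nonneg.2 h; positivity)).2
        fun x => norm_add_integral_Lp_le a g x.2

theorem antideriv_apply (h : c ≤ d) (a : E) (g : Lp E p (volume.restrict (Ioo c d)))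
    (x : Icc c d) : antideriv 𝕜 h (a, g) x = a + ∫ t in c..(x : ℝ), g t := rfl

theorem antideriv_left (h : c ≤ d) (a : E) (g : Lp E p (volume.restrict (Ioo c d))) :
    antideriv 𝕜 h (a, g) ⟨c, left_mem_Icc.2 h⟩ = a := by
  rw [antideriv_apply, intervalIntegral.integral_same, add_zero]

theorem isCompactOperator_antideriv [ProperSpace E] (hp : 1 < p) (h : c ≤ d) :
    IsCompactOperator
      (antideriv 𝕜 h : E × Lp E p (volume.restrict (Ioo c d)) →L[𝕜] (Icc c d →ᵇ E)) := by
  set s : ℝ := 1 - 1 / p.toReal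
  have s_pos : 0 < s := one_sub_one_div_toReal_pos hp
  have bound_nonneg : 0 ≤ 1 + (d - c) ^ s := by have := sub_nonneg.2 h; positivity
  refine ⟨_, BoundedContinuousFunction.arzela_ascoli (Metric.closedBall 0 (1 + (d - c) ^ s))
    (isCompact_closedBall _ _) (antideriv 𝕜 h '' Metric.closedBall 0 1) ?bounded ?equicontinuous,
    mem_of_superset (Metric.closedBall_mem_nhds _ one_pos)
      ((subset_preimage_image _ _).trans (preimage_mono subset_closure))⟩
  case bounded =>
    rintro _ x ⟨⟨a, g⟩, hag, rfl⟩
    rw [mem_closedBall_zero_iff] at hag ⊢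
    exact (norm_add_integral_Lp_le a g x.2).trans (mul_le_of_le_one_right bound_nonneg hag)
  case equicontinuous =>
    intro x
    have modulus_tendsto : Tendsto (fun y => dist x y ^ s) (𝓝 x) (𝓝 0) := by
      have := ((continuous_const.dist continuous_id).rpow_const
        fun _ => Or.inr s_pos.le : Continuous fun y => dist x y ^ s).tendsto x
      simpa only [id, dist_self, Real.zero_rpow s_pos.ne'] using this
    refine Metric.equicontinuousAt_of_continuity_modulus _ modulus_tendsto _
      (Eventually.of_forall ?_)
    rintro y ⟨_, ⟨a, g⟩, hag, rfl⟩
    have norm_le_one : ‖g‖ ≤ 1 := (norm_snd_le (a, g)).trans (mem_closedBall_zero_iff.1 hag)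
    change dist (a + _) (a + _) ≤ _
    rw [dist_add_left]
    exact (dist_integral_Lp_le g x.2 y.2).trans
      (mul_le_of_le_one_right (Real.rpow_nonneg dist_nonneg _) norm_le_one)

theorem IccExtend_antideriv_eqOn (h : c ≤ d) (a : E) (g : Lp E p (volume.restrict (Ioo c d))) :
    EqOn (IccExtend h (antideriv 𝕜 h (a, g))) (fun x => a + ∫ t in c..x, g t) (Icc c d) :=
  fun _ hx => IccExtend_of_mem h _ hx

theorem absolutelyContinuousOnInterval_antideriv (h : c ≤ d) (a : E)
    (g : Lp E p (volume.restrict (Ioo c d))) :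
    AbsolutelyContinuousOnInterval (IccExtend h (antideriv 𝕜 h (a, g))) c d := by
  refine absolutelyContinuousOnInterval_of_dist_le (absolutelyContinuousOnInterval_integral
    (intervalIntegrable_Lp g (left_mem_Icc.2 h) (right_mem_Icc.2 h))) fun x hx y hy => ?_
  rw [uIcc_of_le h] at hx hy
  rw [IccExtend_antideriv_eqOn h a g hx, IccExtend_antideriv_eqOn h a g hy, dist_add_left]

theorem ae_hasDerivAt_antideriv [CompleteSpace E] (h : c ≤ d) (a : E)
    (g : Lp E p (volume.restrict (Ioo c d))) :
    ∀ᵐ x ∂volume.restrict (Ioo c d), HasDerivAt (IccExtend h (antideriv 𝕜 h (a, g))) (g x) x := by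
  rw [ae_restrict_iff' measurableSet_Ioo]
  filter_upwards [(intervalIntegrable_Lp g (left_mem_Icc.2 h)
    (right_mem_Icc.2 h)).ae_hasDerivAt_integral] with x hasDerivAt_integral hx
  rw [uIcc_of_le h] at hasDerivAt_integral
  exact ((hasDerivAt_integral (Ioo_subset_Icc_self hx) c (left_mem_Icc.2 h)).const_add
    a).congr_of_eventuallyEq ((IccExtend_antideriv_eqOn h a g).eventuallyEq_of_mem
      (Icc_mem_nhds hx.1 hx.2))

theorem hasDerivAt_antideriv_contToLp [CompleteSpace E] (h : c ≤ d) (a : E) (v : Icc c d →ᵇ E)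
    {x : ℝ} (hx : x ∈ Ioo c d) :
    HasDerivAt (IccExtend h (antideriv 𝕜 h (a, contToLp 𝕜 p h v))) (IccExtend h v x) x := by
  have extend_eqOn : EqOn (IccExtend h (antideriv 𝕜 h (a, contToLp 𝕜 p h v)))
      (fun y => a + ∫ t in c..y, IccExtend h v t) (Icc c d) := fun y hy => by
    rw [IccExtend_antideriv_eqOn h a _ hy]
    exact congrArg (a + ·) (intervalIntegral_congr_ae_restrict_Ioo (coeFn_contToLp h v) hy)
  exact (((continuous_IccExtend h v).integral_hasStrictDerivAt c x).hasDerivAt.const_add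
    a).congr_of_eventuallyEq (extend_eqOn.eventuallyEq_of_mem (Icc_mem_nhds hx.1 hx.2))

theorem antideriv_injective [CompleteSpace E] (h : c ≤ d) :
    Function.Injective
      (antideriv 𝕜 h : E × Lp E p (volume.restrict (Ioo c d)) →L[𝕜] (Icc c d →ᵇ E)) := by
  rintro ⟨a, f⟩ ⟨b, g⟩ hab
  refine Prod.ext ?_ (Lp.ext ?_)
  · simpa only [antideriv_left] using DFunLike.congr_fun hab ⟨c, left_mem_Icc.2 h⟩
  · filter_upwards [ae_hasDerivAt_antideriv (𝕜 := 𝕜) h a f,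
      ae_hasDerivAt_antideriv (𝕜 := 𝕜) h b g] with x hf hg
    rw [hab] at hf
    exact hf.unique hg

end Antideriv

end Interval

theorem continuous_of_mul_norm_sq_le {F X Y : Type*} [SeminormedAddCommGroup X]
    [SeminormedAddCommGroup Y] [FunLike F X Y] [AddMonoidHomClass F X Y] {c : ℝ} (hc : 0 < c)
    (f : F) (h : ∀ x, c * ‖f x‖ ^ 2 ≤ ‖x‖ ^ 2) : Continuous f := by
  refine AddMonoidHomClass.continuous_of_bound f (√c)⁻¹ fun x => ?_
  rw [inv_mul_eq_div, le_div_iff₀' (Real.sqrt_pos.2 hc)]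
  refine (pow_le_pow_iff_left₀ (by positivity) (norm_nonneg x) two_ne_zero).1 ?_
  rw [mul_pow, Real.sq_sqrt hc.le]
  exact h x

namespace BVTP

variable {n : ℕ} (P : BVTP n)

section HilbertSpace

/-- The space of square integrable functions on the `k`-th piece. -/
abbrev L2 (k : Fin (n + 1)) : Type :=
  Lp ℂ 2 (volume.restrict (Ioo (P.ξ k.castSucc) (P.ξ k.succ)))

theorem norm_sq_eq (F : P.H) : ‖F‖ ^ 2 =
    ∑ k, P.weight k * ‖F.1 k‖ ^ 2 + P.weightA * ‖F.2.1‖ ^ 2 + P.weightB * ‖F.2.2‖ ^ 2 := by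
  rw [norm_sq_eq_re_inner (𝕜 := ℂ) F]
  change RCLike.re (P.innerH F F) = _
  rw [innerH_self]
  exact Complex.ofReal_re _

theorem sum_weight_mul_norm_sq_nonneg (F : P.H) : 0 ≤ ∑ k, P.weight k * ‖F.1 k‖ ^ 2 :=
  Finset.sum_nonneg fun k _ => mul_nonneg (P.weight_pos k).le (sq_nonneg _)

theorem weightA_mul_norm_sq_nonneg (F : P.H) : 0 ≤ P.weightA * ‖F.2.1‖ ^ 2 :=
  mul_nonneg P.weightA_pos.le (sq_nonneg _)

theorem weightB_mul_norm_sq_nonneg (F : P.H) : 0 ≤ P.weightB * ‖F.2.2‖ ^ 2 :=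
  mul_nonneg P.weightB_pos.le (sq_nonneg _)

theorem weight_mul_norm_sq_le (F : P.H) (k : Fin (n + 1)) :
    P.weight k * ‖F.1 k‖ ^ 2 ≤ ‖F‖ ^ 2 := by
  have le_sum := Finset.single_le_sum (f := fun k => P.weight k * ‖F.1 k‖ ^ 2)
    (fun k _ => mul_nonneg (P.weight_pos k).le (sq_nonneg _)) (Finset.mem_univ k)
  rw [norm_sq_eq]
  linarith [P.weightA_mul_norm_sq_nonneg F, P.weightB_mul_norm_sq_nonneg F]

theorem weightA_mul_norm_sq_le (F : P.H) : P.weightA * ‖F.2.1‖ ^ 2 ≤ ‖F‖ ^ 2 := by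
  rw [norm_sq_eq]
  linarith [P.sum_weight_mul_norm_sq_nonneg F, P.weightB_mul_norm_sq_nonneg F]

theorem weightB_mul_norm_sq_le (F : P.H) : P.weightB * ‖F.2.2‖ ^ 2 ≤ ‖F‖ ^ 2 := by
  rw [norm_sq_eq]
  linarith [P.sum_weight_mul_norm_sq_nonneg F, P.weightA_mul_norm_sq_nonneg F]

/-- The algebraic identity between the Hilbert space and the product of its components. -/
def coordsLinear : P.H ≃ₗ[ℂ] ((k : Fin (n + 1)) → P.L2 k) × ℂ × ℂ := LinearEquiv.refl ℂ _

theorem continuous_coordsLinear : Continuous P.coordsLinear := by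
  have components (k : Fin (n + 1)) : Continuous fun F : P.H => F.1 k :=
    continuous_of_mul_norm_sq_le (P.weight_pos k)
      ((LinearMap.proj k ∘ₗ LinearMap.fst ℂ _ _) ∘ₗ P.coordsLinear.toLinearMap)
      fun F => P.weight_mul_norm_sq_le F k
  have component_a : Continuous fun F : P.H => F.2.1 :=
    continuous_of_mul_norm_sq_le P.weightA_pos
      ((LinearMap.fst ℂ ℂ ℂ ∘ₗ LinearMap.snd ℂ _ _) ∘ₗ P.coordsLinear.toLinearMap)
      P.weightA_mul_norm_sq_le
  have component_b : Continuous fun F : P.H => F.2.2 :=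
    continuous_of_mul_norm_sq_le P.weightB_pos
      ((LinearMap.snd ℂ ℂ ℂ ∘ₗ LinearMap.snd ℂ _ _) ∘ₗ P.coordsLinear.toLinearMap)
      P.weightB_mul_norm_sq_le
  exact (continuous_pi components).prodMk (component_a.prodMk component_b)

theorem continuous_coordsLinear_symm : Continuous P.coordsLinear.symm := by
  have norm_eq : (fun x => ‖P.coordsLinear.symm x‖) = fun x => √(∑ k, P.weight k * ‖x.1 k‖ ^ 2
      + P.weightA * ‖x.2.1‖ ^ 2 + P.weightB * ‖x.2.2‖ ^ 2) := funext fun x => by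
    rw [← Real.sqrt_sq (norm_nonneg (P.coordsLinear.symm x)), norm_sq_eq]
    rfl
  have continuous_norm : Continuous fun x => ‖P.coordsLinear.symm x‖ := by
    rw [norm_eq]
    fun_prop
  refine continuous_of_continuousAt_zero P.coordsLinear.symm ?_
  rw [ContinuousAt, map_zero, tendsto_zero_iff_norm_tendsto_zero]
  simpa only [map_zero, norm_zero] using continuous_norm.tendsto 0

/-- The Hilbert space has the topology of the product of its components, in spite of the weights in
its norm. -/
def coords : P.H ≃L[ℂ] ((k : Fin (n + 1)) → P.L2 k) × ℂ × ℂ where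
  toLinearEquiv := P.coordsLinear
  continuous_toFun := P.continuous_coordsLinear
  continuous_invFun := P.continuous_coordsLinear_symm

/-- The component of an element of the Hilbert space on the `k`-th piece. -/
def component (k : Fin (n + 1)) : P.H →L[ℂ] P.L2 k :=
  .proj k ∘L .fst ℂ _ _ ∘L P.coords.toContinuousLinearMap

/-- The first of the two numbers in an element `(f, f₁, f₂)` of the Hilbert space. -/
def valueA : P.H →L[ℂ] ℂ := .fst ℂ _ _ ∘L .snd ℂ _ _ ∘L P.coords.toContinuousLinearMap

/-- The second of the two numbers in an element `(f, f₁, f₂)` of the Hilbert space. -/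
def valueB : P.H →L[ℂ] ℂ := .snd ℂ _ _ ∘L .snd ℂ _ _ ∘L P.coords.toContinuousLinearMap

end HilbertSpace

section FirstOrderSystem

theorem ξ_lt (k : Fin (n + 1)) : P.ξ k.castSucc < P.ξ k.succ :=
  P.ξ_strictMono Fin.castSucc_lt_succ

/-- The space of continuous functions on the closure of the `k`-th piece. -/
abbrev ContPiece (k : Fin (n + 1)) : Type := Icc (P.ξ k.castSucc) (P.ξ k.succ) →ᵇ ℂ

/-- The inclusion of the continuous functions into the square integrable ones on a piece. -/
abbrev toL2 (k : Fin (n + 1)) : P.ContPiece k →L[ℂ] P.L2 k := contToLp ℂ 2 (P.ξ_lt k).le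

/-- The antiderivative on the `k`-th piece of a square integrable function, with a given value at
the left end point. -/
abbrev primitive (k : Fin (n + 1)) : ℂ × P.L2 k →L[ℂ] P.ContPiece k := antideriv ℂ (P.ξ_lt k).le

/-- The left end point of the `k`-th piece. -/
def left (k : Fin (n + 1)) : Icc (P.ξ k.castSucc) (P.ξ k.succ) :=
  ⟨P.ξ k.castSucc, left_mem_Icc.2 (P.ξ_lt k).le⟩

/-- The right end point of the `k`-th piece. -/
def right (k : Fin (n + 1)) : Icc (P.ξ k.castSucc) (P.ξ k.succ) :=
  ⟨P.ξ k.succ, right_mem_Icc.2 (P.ξ_lt k).le⟩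

/-- The phase space of the first-order system: on each piece a function `w.1 k`, which stands for
the solution, and a function `w.2 k`, which stands for its derivative. -/
abbrev Phase : Type := ((k : Fin (n + 1)) → P.ContPiece k) × ((k : Fin (n + 1)) → P.ContPiece k)

/-- Evaluation of the function component of a phase at a point of the `k`-th piece. -/
def fnAt (k : Fin (n + 1)) (x : Icc (P.ξ k.castSucc) (P.ξ k.succ)) : P.Phase →L[ℂ] ℂ :=
  BoundedContinuousFunction.evalCLM ℂ x ∘L .proj k ∘L .fst ℂ _ _

/-- Evaluation of the derivative component of a phase at a point of the `k`-th piece. -/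
def derAt (k : Fin (n + 1)) (x : Icc (P.ξ k.castSucc) (P.ξ k.succ)) : P.Phase →L[ℂ] ℂ :=
  BoundedContinuousFunction.evalCLM ℂ x ∘L .proj k ∘L .snd ℂ _ _

/-- The boundary functional `α f(a) - β f'(a)`. -/
def boundaryA (α β : ℝ) : P.Phase →L[ℂ] ℂ :=
  (α : ℂ) • P.fnAt 0 (P.left 0) - (β : ℂ) • P.derAt 0 (P.left 0)

/-- The boundary functional `α f(b) - β f'(b)`. -/
def boundaryB (α β : ℝ) : P.Phase →L[ℂ] ℂ :=
  (α : ℂ) • P.fnAt (Fin.last n) (P.right _) - (β : ℂ) • P.derAt (Fin.last n) (P.right _)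

/-- The transmission functional at the `i`-th interior point; `m1`, `m0`, `p1`, `p0` multiply
`f'(ξ-)`, `f(ξ-)`, `f'(ξ+)`, `f(ξ+)`. -/
def transmission (i : Fin n) (m1 m0 p1 p0 : ℝ) : P.Phase →L[ℂ] ℂ :=
  (m1 : ℂ) • P.derAt i.castSucc (P.right _) + (m0 : ℂ) • P.fnAt i.castSucc (P.right _)
    + (p1 : ℂ) • P.derAt i.succ (P.left _) + (p0 : ℂ) • P.fnAt i.succ (P.left _)

/-- The element `(f, B'_a[f], -B'_b[f])` of the Hilbert space given by a phase. -/
def toH : P.Phase →L[ℂ] P.H :=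
  P.coords.symm.toContinuousLinearMap ∘L
    (ContinuousLinearMap.pi fun k => P.toL2 k ∘L .proj k ∘L .fst ℂ _ _).prod
      ((P.boundaryA P.δ₃ P.δ₄).prod (-P.boundaryB P.γ₃ P.γ₄))

/-- The condition at `a` (for `k = 0`) and the first transmission conditions, as functionals which
are to vanish at solutions of `(R - z) F = G`. -/
def residualA (z : ℂ) : Fin (n + 1) → P.Phase × P.H →L[ℂ] ℂ :=
  Fin.cases ((P.boundaryA P.δ₁ P.δ₂ - z • P.boundaryA P.δ₃ P.δ₄) ∘L .fst ℂ _ _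
      - P.valueA ∘L .snd ℂ _ _)
    fun i => P.transmission i (P.δm1 i) (P.δm0 i) (P.δp1 i) (P.δp0 i) ∘L .fst ℂ _ _

/-- The condition at `b` (for `k = 0`) and the second transmission conditions, as functionals which
are to vanish at solutions of `(R - z) F = G`. -/
def residualB (z : ℂ) : Fin (n + 1) → P.Phase × P.H →L[ℂ] ℂ :=
  Fin.cases ((P.boundaryB P.γ₁ P.γ₂ + z • P.boundaryB P.γ₃ P.γ₄) ∘L .fst ℂ _ _
      - P.valueB ∘L .snd ℂ _ _)
    fun i => P.transmission i (P.γm1 i) (P.γm0 i) (P.γp1 i) (P.γp0 i) ∘L .fst ℂ _ _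

/-- The continuous extension of `q - z` to the closure of the `k`-th piece. -/
def potential (z : ℂ) (k : Fin (n + 1)) : P.ContPiece k :=
  BoundedContinuousFunction.mkOfCompact
    ⟨fun x => ((extendFrom (Ioo (P.ξ k.castSucc) (P.ξ k.succ)) P.q x : ℝ) : ℂ) - z, by
      obtain ⟨l, hl⟩ := P.q_right_limit k
      obtain ⟨r, hr⟩ := P.q_left_limit k
      have := (continuousOn_Icc_extendFrom_Ioo (P.q_continuousOn k) hl hr).domRestrict
      exact (Complex.continuous_ofReal.comp this).sub continuous_const⟩

theorem potential_apply (z : ℂ) {k : Fin (n + 1)} {x : ℝ} (hx : x ∈ P.piece k) :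
    P.potential z k ⟨x, Ioo_subset_Icc_self hx⟩ = P.q x - z :=
  congrArg (fun y : ℝ => (y : ℂ) - z)
    (extendFrom_eq (subset_closure hx) (P.q_continuousOn k x hx))

/-- The second derivative `ρ⁻² ((q - z) f - g)` prescribed by `ℓ f = z f + g` on the `k`-th piece,
where `f` is the function component of the phase and `g` the component of the element of `H`. -/
def acceleration (z : ℂ) (k : Fin (n + 1)) : P.Phase × P.H →L[ℂ] P.L2 k :=
  ((P.ρ k ^ 2 : ℝ) : ℂ)⁻¹ •
    (P.toL2 k ∘L .mul ℂ _ (P.potential z k) ∘L .proj k ∘L .fst ℂ _ _ ∘L .fst ℂ _ _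
      - P.component k ∘L .snd ℂ _ _)

/-- The operator whose fixed points `system z (w, G) = w` are the phases of the solutions `F` of
`(R - z) F = G`. Each of the `2 (n + 1)` integral equations uses up one of the `2 (n + 1)` boundary
and transmission conditions: the initial value on the right is the one on the left minus a residual,
so that evaluation at the left end point of the piece makes the residual vanish. -/
def system (z : ℂ) : P.Phase × P.H →L[ℂ] P.Phase :=
  (ContinuousLinearMap.pi fun k => P.primitive k ∘L
      (P.fnAt k (P.left k) ∘L .fst ℂ _ _ - P.residualA z k).prod
        (P.toL2 k ∘L .proj k ∘L .snd ℂ _ _ ∘L .fst ℂ _ _)).prod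
    (ContinuousLinearMap.pi fun k => P.primitive k ∘L
      (P.derAt k (P.left k) ∘L .fst ℂ _ _ - P.residualB z k).prod (P.acceleration z k))

theorem primitive_left (k : Fin (n + 1)) (r : ℂ) (g : P.L2 k) :
    P.primitive k (r, g) (P.left k) = r :=
  antideriv_left (P.ξ_lt k).le r g

theorem isCompactOperator_primitive (k : Fin (n + 1)) : IsCompactOperator (P.primitive k) :=
  isCompactOperator_antideriv ENNReal.one_lt_two (P.ξ_lt k).le

theorem isCompactOperator_system (z : ℂ) : IsCompactOperator (P.system z) :=
  isCompactOperator_prodMk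
    (isCompactOperator_pi fun k => (P.isCompactOperator_primitive k).comp_clm (.prod _ _))
    (isCompactOperator_pi fun k => (P.isCompactOperator_primitive k).comp_clm (.prod _ _))

variable {P}

theorem eq_primitive_of_eq_primitive_sub {k : Fin (n + 1)} {u : P.ContPiece k} {r : ℂ}
    {g : P.L2 k} (hu : u = P.primitive k (u (P.left k) - r, g)) :
    r = 0 ∧ u = P.primitive k (u (P.left k), g) := by
  have r_eq_zero : r = 0 := by
    have eq_sub := DFunLike.congr_fun hu (P.left k)
    rwa [primitive_left, eq_comm, sub_eq_self] at eq_sub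
  exact ⟨r_eq_zero, by rwa [r_eq_zero, sub_zero] at hu⟩

/-- The phase `w` solves the first-order system, including the boundary and transmission
conditions, equivalent to `(R - z) F = G`. -/
structure Solves (z : ℂ) (w : P.Phase) (G : P.H) : Prop where
  fn_eq : ∀ k, w.1 k = P.primitive k (w.1 k (P.left k), P.toL2 k (w.2 k))
  der_eq : ∀ k, w.2 k = P.primitive k (w.2 k (P.left k), P.acceleration z k (w, G))
  residualA_eq_zero : ∀ k, P.residualA z k (w, G) = 0
  residualB_eq_zero : ∀ k, P.residualB z k (w, G) = 0

theorem solves_of_system_eq {z : ℂ} {w : P.Phase} {G : P.H} (h : P.system z (w, G) = w) :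
    Solves z w G := by
  have fn_eq (k : Fin (n + 1)) :=
    eq_primitive_of_eq_primitive_sub (congrFun (congrArg Prod.fst h.symm) k :
      w.1 k = P.primitive k (w.1 k (P.left k) - P.residualA z k (w, G), P.toL2 k (w.2 k)))
  have der_eq (k : Fin (n + 1)) :=
    eq_primitive_of_eq_primitive_sub (congrFun (congrArg Prod.snd h.symm) k :
      w.2 k = P.primitive k (w.2 k (P.left k) - P.residualB z k (w, G),
        P.acceleration z k (w, G)))
  exact ⟨fun k => (fn_eq k).2, fun k => (der_eq k).2, fun k => (fn_eq k).1, fun k => (der_eq k).1⟩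

end FirstOrderSystem

section Solutions

theorem pairwise_disjoint_piece : Pairwise (Function.onFun Disjoint P.piece) :=
  (pairwise_disjoint_on P.piece).2 fun j k hjk => by
    have ξ_le : P.ξ j.succ ≤ P.ξ k.castSucc :=
      P.ξ_strictMono.monotone (Fin.succ_le_castSucc_iff.2 hjk)
    exact Set.disjoint_left.2 fun x hxj hxk => (hxj.2.trans_le ξ_le).not_gt hxk.1

variable {P}

/-- The function on the line which agrees with `u k` on the `k`-th piece, for all `k`. -/
def glue (u : (k : Fin (n + 1)) → P.ContPiece k) (x : ℝ) : ℂ :=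
  ∑ k, (P.piece k).indicator (IccExtend (P.ξ_lt k).le (u k)) x

theorem glue_eqOn (u : (k : Fin (n + 1)) → P.ContPiece k) (k : Fin (n + 1)) :
    EqOn (glue u) (IccExtend (P.ξ_lt k).le (u k)) (P.piece k) := fun x hx => by
  rw [glue, Finset.sum_eq_single_of_mem k (Finset.mem_univ k), indicator_of_mem hx]
  exact fun j _ hj => indicator_of_notMem
    (fun hxj => Set.disjoint_left.1 (P.pairwise_disjoint_piece hj) hxj hx) _

theorem coeFn_toL2 (u : (k : Fin (n + 1)) → P.ContPiece k) (k : Fin (n + 1)) :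
    P.toL2 k (u k) =ᵐ[volume.restrict (P.piece k)] glue u :=
  (coeFn_contToLp (P.ξ_lt k).le (u k)).trans
    ((glue_eqOn u k).symm.aeEq_restrict measurableSet_Ioo)

theorem coeFn_acceleration (z : ℂ) (w : P.Phase) (G : P.H) (k : Fin (n + 1)) :
    P.acceleration z k (w, G) =ᵐ[volume.restrict (P.piece k)] fun x =>
      ((P.ρ k ^ 2 : ℝ) : ℂ)⁻¹ * ((P.q x - z) * glue w.1 x - P.component k G x) := by
  set v := P.toL2 k (P.potential z k * w.1 k)
  have toL2_mul_eq : v =ᵐ[volume.restrict (P.piece k)] fun x => (P.q x - z) * glue w.1 x := by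
    filter_upwards [coeFn_contToLp (𝕜 := ℂ) (p := 2) (P.ξ_lt k).le (P.potential z k * w.1 k),
      ae_restrict_mem measurableSet_Ioo] with x hx x_mem
    rw [hx, glue_eqOn w.1 k x_mem, IccExtend_of_mem _ _ (Ioo_subset_Icc_self x_mem),
      IccExtend_of_mem _ _ (Ioo_subset_Icc_self x_mem), BoundedContinuousFunction.mul_apply,
      P.potential_apply z x_mem]
  filter_upwards [toL2_mul_eq, Lp.coeFn_sub v (P.component k G),
    Lp.coeFn_smul ((P.ρ k ^ 2 : ℝ) : ℂ)⁻¹ (v - P.component k G)] with x mul_eq sub_eq smul_eq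
  rw [← mul_eq, ← Pi.sub_apply, ← sub_eq, ← smul_eq_mul, ← Pi.smul_apply, ← smul_eq]
  rfl

theorem rightLim_glue (w : P.Phase) (k : Fin (n + 1)) :
    Function.rightLim (glue w.1) (P.ξ k.castSucc) = P.fnAt k (P.left k) w :=
  rightLim_eq_of_tendsto (tendsto_nhdsGT_of_eqOn_IccExtend (P.ξ_lt k) (glue_eqOn w.1 k))

theorem leftLim_glue (w : P.Phase) (k : Fin (n + 1)) :
    Function.leftLim (glue w.1) (P.ξ k.succ) = P.fnAt k (P.right k) w :=
  leftLim_eq_of_tendsto (tendsto_nhdsLT_of_eqOn_IccExtend (P.ξ_lt k) (glue_eqOn w.1 k))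

theorem acLoc_of_eqOn_primitive {k : Fin (n + 1)} {f : ℝ → ℂ} {r : ℂ} {g : P.L2 k}
    (hf : EqOn f (IccExtend (P.ξ_lt k).le (P.primitive k (r, g))) (P.piece k)) :
    ACLoc f (P.ξ k.castSucc) (P.ξ k.succ) := by
  refine ACLoc.congr (fun x hx y hy => ?_) hf.symm
  refine (absolutelyContinuousOnInterval_antideriv (P.ξ_lt k).le r g).mono ?_
  rw [uIcc_of_le (P.ξ_lt k).le]
  exact ordConnected_Icc.uIcc_subset (Ioo_subset_Icc_self hx) (Ioo_subset_Icc_self hy)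

namespace Solves

variable {z : ℂ} {w : P.Phase} {G : P.H}

theorem hasDerivAt_glue (h : Solves z w G) {k : Fin (n + 1)} {x : ℝ} (hx : x ∈ P.piece k) :
    HasDerivAt (glue w.1) (IccExtend (P.ξ_lt k).le (w.2 k) x) x := by
  have hasDerivAt_extend := hasDerivAt_antideriv_contToLp (𝕜 := ℂ) (p := 2) (P.ξ_lt k).le
    (w.1 k (P.left k)) (w.2 k) hx
  rw [← h.fn_eq k] at hasDerivAt_extend
  exact hasDerivAt_extend.congr_of_eventuallyEq
    ((glue_eqOn w.1 k).eventuallyEq_of_mem ((P.isOpen_piece k).mem_nhds hx))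

theorem deriv_glue_eqOn (h : Solves z w G) (k : Fin (n + 1)) :
    EqOn (deriv (glue w.1)) (IccExtend (P.ξ_lt k).le (w.2 k)) (P.piece k) :=
  fun _ hx => (h.hasDerivAt_glue hx).deriv

theorem rightLim_deriv_glue (h : Solves z w G) (k : Fin (n + 1)) :
    Function.rightLim (deriv (glue w.1)) (P.ξ k.castSucc) = P.derAt k (P.left k) w :=
  rightLim_eq_of_tendsto (tendsto_nhdsGT_of_eqOn_IccExtend (P.ξ_lt k) (h.deriv_glue_eqOn k))

theorem leftLim_deriv_glue (h : Solves z w G) (k : Fin (n + 1)) :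
    Function.leftLim (deriv (glue w.1)) (P.ξ k.succ) = P.derAt k (P.right k) w :=
  leftLim_eq_of_tendsto (tendsto_nhdsLT_of_eqOn_IccExtend (P.ξ_lt k) (h.deriv_glue_eqOn k))

theorem deriv_deriv_glue_ae_eq (h : Solves z w G) (k : Fin (n + 1)) :
    deriv (deriv (glue w.1)) =ᵐ[volume.restrict (P.piece k)] P.acceleration z k (w, G) := by
  have ae_hasDerivAt_extend := ae_hasDerivAt_antideriv (𝕜 := ℂ) (P.ξ_lt k).le
    (w.2 k (P.left k)) (P.acceleration z k (w, G))
  rw [← h.der_eq k] at ae_hasDerivAt_extend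
  filter_upwards [ae_hasDerivAt_extend, ae_restrict_mem measurableSet_Ioo] with x hasDerivAt hx
  exact (hasDerivAt.congr_of_eventuallyEq
    ((h.deriv_glue_eqOn k).eventuallyEq_of_mem ((P.isOpen_piece k).mem_nhds hx))).deriv

theorem ell_glue_ae_eq (h : Solves z w G) (k : Fin (n + 1)) :
    P.ell k (glue w.1) =ᵐ[volume.restrict (P.piece k)] (G + z • P.toH w).1 k := by
  have ρ_sq_ne_zero : ((P.ρ k ^ 2 : ℝ) : ℂ) ≠ 0 := Complex.ofReal_ne_zero.2 (P.ρ_sq_pos k).ne'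
  filter_upwards [h.deriv_deriv_glue_ae_eq k, coeFn_acceleration z w G k, coeFn_toL2 w.1 k,
    Lp.coeFn_smul z (P.toL2 k (w.1 k)), Lp.coeFn_add (P.component k G) (z • P.toL2 k (w.1 k))]
    with x deriv_deriv_eq acceleration_eq toL2_eq smul_eq add_eq
  calc P.ell k (glue w.1) x
      = -((P.ρ k ^ 2 : ℝ) : ℂ) * (((P.ρ k ^ 2 : ℝ) : ℂ)⁻¹ *
          ((P.q x - z) * glue w.1 x - P.component k G x)) + P.q x * glue w.1 x := by
        rw [ell, deriv_deriv_eq, acceleration_eq]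
    _ = P.component k G x + z * glue w.1 x := by
        rw [neg_mul, mul_inv_cancel_left₀ ρ_sq_ne_zero]
        ring
    _ = (P.component k G + z • P.toL2 k (w.1 k)) x := by
        rw [add_eq, Pi.add_apply, smul_eq, Pi.smul_apply, toL2_eq, smul_eq_mul]

theorem admissible_glue (h : Solves z w G) : P.Admissible (glue w.1) where
  differentiableOn k x hx := (h.hasDerivAt_glue hx).differentiableAt.differentiableWithinAt
  acLoc k := acLoc_of_eqOn_primitive (h.fn_eq k ▸ glue_eqOn w.1 k)
  acLoc_deriv k := acLoc_of_eqOn_primitive (h.der_eq k ▸ h.deriv_glue_eqOn k)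
  right_limit k := ⟨_, tendsto_nhdsGT_of_eqOn_IccExtend (P.ξ_lt k) (glue_eqOn w.1 k)⟩
  left_limit k := ⟨_, tendsto_nhdsLT_of_eqOn_IccExtend (P.ξ_lt k) (glue_eqOn w.1 k)⟩
  right_limit_deriv k := ⟨_, tendsto_nhdsGT_of_eqOn_IccExtend (P.ξ_lt k) (h.deriv_glue_eqOn k)⟩
  left_limit_deriv k := ⟨_, tendsto_nhdsLT_of_eqOn_IccExtend (P.ξ_lt k) (h.deriv_glue_eqOn k)⟩
  memLp_ell k := (memLp_congr_ae (h.ell_glue_ae_eq k)).2 (Lp.memLp _)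
  trans₁_eq i := by
    rw [trans₁, node_eq, h.leftLim_deriv_glue, leftLim_glue, Fin.succ_castSucc,
      h.rightLim_deriv_glue, rightLim_glue]
    exact h.residualA_eq_zero i.succ
  trans₂_eq i := by
    rw [trans₂, node_eq, h.leftLim_deriv_glue, leftLim_glue, Fin.succ_castSucc,
      h.rightLim_deriv_glue, rightLim_glue]
    exact h.residualB_eq_zero i.succ

theorem represents_glue (h : Solves z w G) :
    P.Represents (glue w.1) (P.toH w) (G + z • P.toH w) where
  admissible := h.admissible_glue
  fst_eq := coeFn_toL2 w.1
  fst_a := by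
    rw [Ba', a_eq, rightLim_glue, h.rightLim_deriv_glue]
    rfl
  fst_b := by
    rw [Bb', b_eq, leftLim_glue, h.leftLim_deriv_glue]
    rfl
  snd_eq k := (h.ell_glue_ae_eq k).symm
  snd_a := by
    have residual_eq_zero : P.boundaryA P.δ₁ P.δ₂ w - z * P.boundaryA P.δ₃ P.δ₄ w - G.2.1 = 0 :=
      h.residualA_eq_zero 0
    rw [Ba, a_eq, rightLim_glue, h.rightLim_deriv_glue]
    change G.2.1 + z * P.boundaryA P.δ₃ P.δ₄ w = P.boundaryA P.δ₁ P.δ₂ w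
    linear_combination -residual_eq_zero
  snd_b := by
    have residual_eq_zero : P.boundaryB P.γ₁ P.γ₂ w + z * P.boundaryB P.γ₃ P.γ₄ w - G.2.2 = 0 :=
      h.residualB_eq_zero 0
    rw [Bb, b_eq, leftLim_glue, h.leftLim_deriv_glue]
    change G.2.2 + z * -P.boundaryB P.γ₃ P.γ₄ w = P.boundaryB P.γ₁ P.γ₂ w
    linear_combination -residual_eq_zero

theorem mem_graph (h : Solves z w G) : (P.toH w, G + z • P.toH w) ∈ P.op.graph := by
  rw [op_graph]
  exact ⟨_, h.represents_glue⟩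

theorem eq_zero (h : Solves z w 0) (hw : P.toH w = 0) : w = 0 := by
  have fn_eq_zero (k : Fin (n + 1)) : w.1 k = 0 :=
    contToLp_injective (𝕜 := ℂ) (p := 2) (P.ξ_lt k)
      ((congrFun (congrArg Prod.fst hw) k).trans (map_zero _).symm)
  have der_eq_zero (k : Fin (n + 1)) : w.2 k = 0 := by
    have primitive_eq_zero := (h.fn_eq k).symm.trans (fn_eq_zero k)
    rw [← map_zero (P.primitive k)] at primitive_eq_zero
    have toL2_eq_zero := congrArg Prod.snd (antideriv_injective (P.ξ_lt k).le primitive_eq_zero)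
    exact contToLp_injective (P.ξ_lt k) (toL2_eq_zero.trans (map_zero _).symm)
  exact Prod.ext (funext fn_eq_zero) (funext der_eq_zero)

end Solves

end Solutions

end BVTP

theorem mainTheorem3_general {n : ℕ} (P : BVTP n) (z : ℂ) (hz : z ∉ P.op.pointSpectrum) :
    ∃ T : P.H →L[ℂ] P.H, P.op.IsResolventAt z T ∧ IsCompactOperator T := by
  have homogeneous (w : P.Phase) (hw : P.system z (w, 0) = w) : w = 0 := by
    have solves := BVTP.solves_of_system_eq hw
    have mem_graph := solves.mem_graph
    rw [zero_add] at mem_graph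
    exact solves.eq_zero (eq_zero_of_mem_graph_smul hz mem_graph)
  obtain ⟨S, S_compact, hS⟩ :=
    exists_isCompactOperator_fixedPoint (P.isCompactOperator_system z) homogeneous
  exact ⟨P.toH ∘L S, isResolventAt_of_mem_graph hz fun G =>
    (BVTP.solves_of_system_eq (hS G)).mem_graph, S_compact.clm_comp P.toH⟩

end

theorem mainTheorem3 {n : ℕ} (P : BVTP n) (δ : ℝ) (hδ : (δ : ℂ) ∉ P.op.pointSpectrum) :
    ∃ T : P.H →L[ℂ] P.H, P.op.IsResolventAt (δ : ℂ) T ∧ IsCompactOperator T :=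
  mainTheorem3_general P δ hδ
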